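/- For every integer $n\ge 1$, the function $(x_1,\dots,x_n)\mapsto \log\Gamma(x_1+\cdots+x_n)$ is Lebesgue integrable on $[0,1]^n$, and $$\int_0^1\!\int_0^1\!\cdots\int_0^1 \log\Gamma(x_1+x_2+\cdots+x_n)\,dx_1\,dx_2\cdots dx_n=\frac12\log(2\pi)-\frac{n-1}{2}H_n+\sum_{k=2}^{n-1}\frac{(-1)^{n+k+1}k^n}{n!}\binom{n-1}{k}\log k,$$ where $H_n=\sum_{k=1}^n\frac1k$ and a sum whose upper limit is less than its lower limit is $0$. -/

import Mathlib

open MeasureTheory Set Real intervalIntegral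

/-! Carry a shift `y ≥ 0` and let F_n(y) be the integral of log Γ(y + x_1 + ⋯ + x_n) over the unit
cube. By Fubini, F_{n+1}(y) is the integral of F_n over [y, y+1], and Raabe's formula gives F_1.
Integrating over a unit interval is the forward difference Δ of an antiderivative, so F_{m+1} = Δ^m
R_m, where R_m (`raabePrimitive`) is an m-fold antiderivative of F_1. At y = 0 the y^{m+1} log y
part of R_m gives the binomial sum, and its polynomial part gives the other two terms. -/

theorem continuousOn_log_Gamma : ContinuousOn (fun s : ℝ => log (Gamma s)) (Ioi 0) := by
  intro s hs
  have hs' : (0 : ℝ) < s := hs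
  refine (ContinuousAt.log (differentiableAt_Gamma fun m => ?_).continuousAt
    (Gamma_pos_of_pos hs').ne').continuousWithinAt
  have : (0 : ℝ) ≤ m := m.cast_nonneg
  linarith

theorem log_Gamma_add_one {s : ℝ} (hs : 0 < s) :
    log (Gamma (s + 1)) = log s + log (Gamma s) := by
  rw [Gamma_add_one hs.ne', log_mul hs.ne' (Gamma_pos_of_pos hs).ne']

theorem intervalIntegrable_log_Gamma {a b : ℝ} (ha : 0 ≤ a) (hb : 0 ≤ b) :
    IntervalIntegrable (fun s : ℝ => log (Gamma s)) volume a b := by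
  -- The singularity of log Γ at 0 is only that of -log s, since log Γ(s + 1) is continuous on [0,
  -- ∞).
  have h : IntervalIntegrable (fun s : ℝ => log (Gamma (s + 1)) - log s) volume a b := by
    refine IntervalIntegrable.sub (ContinuousOn.intervalIntegrable ?_) intervalIntegrable_log'
    refine continuousOn_log_Gamma.comp (by fun_prop) fun s hs => ?_
    have := (le_min ha hb).trans hs.1
    exact mem_Ioi.2 (by linarith)
  refine h.congr fun s hs => ?_
  have : 0 < s := (le_min ha hb).trans_lt hs.1
  simp only [log_Gamma_add_one this]
  ring

/-- `∫₀¹ log Γ`, obtained from Euler's reflection formula. -/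
theorem integral_log_Gamma_zero_one :
    ∫ s in (0 : ℝ)..1, log (Gamma s) = 1 / 2 * log (2 * π) := by
  have hI := intervalIntegrable_log_Gamma le_rfl zero_le_one
  have hI' : IntervalIntegrable (fun s : ℝ => log (Gamma (1 - s))) volume 0 1 := by
    simpa using (hI.comp_sub_left 1).symm
  have hsymm : ∫ s in (0 : ℝ)..1, log (Gamma (1 - s)) = ∫ s in (0 : ℝ)..1, log (Gamma s) := by
    simpa using integral_comp_sub_left (fun s => log (Gamma s)) (a := 0) (b := 1) 1
  have hsin : IntervalIntegrable (fun s : ℝ => log (sin (π * s))) volume 0 1 := by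
    simpa [pi_ne_zero] using
      (intervalIntegrable_log_sin (a := 0) (b := π)).comp_mul_left (c := π)
  have hsinval : ∫ s in (0 : ℝ)..1, log (sin (π * s)) = -log 2 := by
    rw [integral_comp_mul_left (fun s => log (sin s)) pi_ne_zero]
    simp only [mul_zero, mul_one, integral_log_sin_zero_pi, smul_eq_mul]
    field_simp
  have hsum : ∫ s in (0 : ℝ)..1, (log (Gamma s) + log (Gamma (1 - s))) =
      ∫ s in (0 : ℝ)..1, (log π - log (sin (π * s))) := by
    refine integral_congr_Ioo_of_le zero_le_one fun s hs => ?_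
    have h1 := Gamma_pos_of_pos hs.1
    have h2 := Gamma_pos_of_pos (sub_pos.2 hs.2)
    have h3 : 0 < sin (π * s) :=
      sin_pos_of_pos_of_lt_pi (mul_pos pi_pos hs.1) (by nlinarith [pi_pos, hs.2])
    rw [← log_mul h1.ne' h2.ne', Gamma_mul_Gamma_one_sub, log_div pi_ne_zero h3.ne']
  rw [integral_add hI hI', hsymm, integral_sub (by simp) hsin, hsinval] at hsum
  rw [log_mul two_ne_zero pi_ne_zero]
  simp at hsum
  linarith

/-- Raabe's formula. -/
theorem integral_log_Gamma_add_one {y : ℝ} (hy : 0 ≤ y) :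
    ∫ s in y..y + 1, log (Gamma s) = y * log y - y + 1 / 2 * log (2 * π) := by
  let P : ℝ → ℝ := fun u => ∫ s in (0 : ℝ)..u, log (Gamma s)
  -- The subtracted term is an antiderivative of log u = log Γ(u + 1) - log Γ(u), so `g` is
  -- constant; its value is read off at 0, hence the need for continuity there.
  let g : ℝ → ℝ := fun u => P (u + 1) - P u - (u * log u - u)
  have hPc : ContinuousOn P (Ici 0) := by
    intro u hu
    have hu' : (0 : ℝ) ≤ u := hu
    have h := continuousOn_primitive_interval (a := 0) (b := u + 1) (μ := volume)
      (f := fun s => log (Gamma s))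
      ((intervalIntegrable_iff' (μ := volume)).1
        (intervalIntegrable_log_Gamma le_rfl (by linarith)))
    rw [uIcc_of_le (by linarith)] at h
    refine (h u ⟨hu', by linarith⟩).mono_of_mem_nhdsWithin ?_
    exact mem_nhdsWithin.2 ⟨Iio (u + 1), isOpen_Iio, by simp, fun v hv => ⟨hv.2, hv.1.le⟩⟩
  have hPd : ∀ u, 0 < u → HasDerivAt P (log (Gamma u)) u := fun u hu =>
    integral_hasDerivAt_right (intervalIntegrable_log_Gamma le_rfl hu.le)
      (continuousOn_log_Gamma.stronglyMeasurableAtFilter isOpen_Ioi u hu)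
      (continuousOn_log_Gamma.continuousAt (Ioi_mem_nhds hu))
  have hgc : ContinuousOn g (Icc 0 y) := by
    refine ((hPc.comp (by fun_prop) fun u hu => ?_).sub (hPc.mono fun u hu => hu.1)).sub
      (continuous_mul_log.sub continuous_id).continuousOn
    exact mem_Ici.2 (by linarith [hu.1])
  have hgd : ∀ u ∈ Ioo 0 y, HasDerivAt g 0 u := fun u hu => by
    have h1 : HasDerivAt (fun v => P (v + 1)) (log (Gamma (u + 1))) u :=
      (hPd (u + 1) (by linarith [hu.1])).comp_add_const u 1
    have h2 := (h1.sub (hPd u hu.1)).sub ((hasDerivAt_mul_log hu.1.ne').sub (hasDerivAt_id u))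
    refine h2.congr_deriv ?_
    rw [log_Gamma_add_one hu.1]
    ring
  have hg := integral_eq_sub_of_hasDerivAt_of_le hy hgc hgd (by simp)
  have h0 : g 0 = 1 / 2 * log (2 * π) := by
    simp [g, P, integral_log_Gamma_zero_one]
  rw [intervalIntegral.integral_zero, h0] at hg
  have hP : ∫ s in y..y + 1, log (Gamma s) = P (y + 1) - P y :=
    (integral_interval_sub_left (intervalIntegrable_log_Gamma le_rfl (by linarith))
      (intervalIntegrable_log_Gamma le_rfl hy)).symm
  rw [hP]
  simp only [g] at hg
  linarith

/-! ### Iterated forward differences -/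

open fwdDiff in
-- Leibniz rule for Δ; only two terms survive because the second difference of x vanishes.
theorem fwdDiff_iter_id_mul (f : ℝ → ℝ) (m : ℕ) (y : ℝ) :
    Δ_[1] ^[m + 1] (fun x => x * f x) y =
      y * Δ_[1] ^[m + 1] f y + (m + 1) * Δ_[1] ^[m] f (y + 1) := by
  induction m generalizing y with
  | zero => simp [fwdDiff]; ring
  | succ m ih =>
    rw [Function.iterate_succ_apply', fwdDiff, ih, ih]
    simp only [Function.iterate_succ_apply', fwdDiff]
    push_cast
    ring

open fwdDiff in
theorem fwdDiff_iter_pow_succ (m : ℕ) (y : ℝ) :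
    Δ_[1] ^[m] (fun x : ℝ => x ^ (m + 1)) y = (m + 1).factorial * (y + m / 2) := by
  induction m generalizing y with
  | zero => simp
  | succ m ih =>
    have h := fwdDiff_iter_id_mul (fun x => x ^ (m + 1)) m y
    rw [ih, fwdDiff_iter_eq_factorial] at h
    simp only [← pow_succ'] at h
    rw [h, Nat.factorial_succ (m + 1)]
    push_cast
    simp
    ring

/-- The `m`-fold antiderivative, polynomial part included, of `y log y - y + log (2π) / 2`. -/
noncomputable def raabePrimitive (m : ℕ) (y : ℝ) : ℝ :=
  y ^ (m + 1) / (m + 1).factorial * (log y - harmonic (m + 1)) +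
    1 / 2 * log (2 * π) * (y ^ m / m.factorial)

theorem continuous_raabePrimitive (m : ℕ) : Continuous (raabePrimitive m) := by
  -- Grouping y log y makes continuity at 0 visible.
  have h : raabePrimitive m = fun y => y ^ m / (m + 1).factorial * (y * log y) -
      y ^ (m + 1) / (m + 1).factorial * harmonic (m + 1) +
        1 / 2 * log (2 * π) * (y ^ m / m.factorial) := by
    ext y
    rw [raabePrimitive]
    ring
  rw [h]
  have := continuous_mul_log
  fun_prop

/-- Differentiating the logarithm adds y^{m+1}/(m+2)!, which lowers H_{m+2} to H_{m+1}. -/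
theorem hasDerivAt_raabePrimitive (m : ℕ) {y : ℝ} (hy : 0 < y) :
    HasDerivAt (raabePrimitive (m + 1)) (raabePrimitive m y) y := by
  have h1 := ((hasDerivAt_pow (m + 2) y).div_const ((m + 2).factorial : ℝ)).mul
    ((hasDerivAt_log hy.ne').sub_const (harmonic (m + 2) : ℝ))
  have h2 := ((hasDerivAt_pow (m + 1) y).div_const ((m + 1).factorial : ℝ)).const_mul
    (1 / 2 * log (2 * π))
  refine (h1.add h2).congr_deriv ?_
  rw [raabePrimitive, harmonic_succ (m + 1), Nat.factorial_succ (m + 1), Nat.factorial_succ m]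
  have : (m.factorial : ℝ) ≠ 0 := by positivity
  push_cast
  field_simp
  ring

open fwdDiff in
theorem continuous_fwdDiff_iter {f : ℝ → ℝ} (hf : Continuous f) (m : ℕ) :
    Continuous (Δ_[1] ^[m] f) := by
  induction m with
  | zero => exact hf
  | succ m ih =>
    rw [Function.iterate_succ_apply']
    exact (ih.comp (continuous_add_const 1)).sub ih

open fwdDiff in
theorem hasDerivAt_fwdDiff_iter {f f' : ℝ → ℝ} (h : ∀ y, 0 < y → HasDerivAt f (f' y) y)
    (m : ℕ) {y : ℝ} (hy : 0 < y) : HasDerivAt (Δ_[1] ^[m] f) (Δ_[1] ^[m] f' y) y := by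
  induction m generalizing y with
  | zero => exact h y hy
  | succ m ih =>
    rw [Function.iterate_succ_apply', Function.iterate_succ_apply']
    exact ((ih (by linarith : 0 < y + 1)).comp_add_const y 1).sub (ih hy)

open fwdDiff in
theorem integral_fwdDiff_iter_raabePrimitive (m : ℕ) {y : ℝ} (hy : 0 ≤ y) :
    ∫ s in y..y + 1, Δ_[1] ^[m] (raabePrimitive m) s =
      Δ_[1] ^[m + 1] (raabePrimitive (m + 1)) y := by
  rw [Function.iterate_succ_apply', fwdDiff]
  exact integral_eq_sub_of_hasDerivAt_of_le (by linarith)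
    (continuous_fwdDiff_iter (continuous_raabePrimitive _) m).continuousOn
    (fun s hs => hasDerivAt_fwdDiff_iter (fun _ => hasDerivAt_raabePrimitive m) m
      (hy.trans_lt hs.1))
    ((continuous_fwdDiff_iter (continuous_raabePrimitive _) m).intervalIntegrable _ _)

open fwdDiff in
theorem fwdDiff_iter_raabePrimitive_zero (m : ℕ) :
    Δ_[1] ^[m] (raabePrimitive m) 0 = 1 / 2 * log (2 * π) - m / 2 * harmonic (m + 1) +
      ∑ k ∈ Finset.Icc 2 m, (-1 : ℝ) ^ (m + k) * (k : ℝ) ^ (m + 1) / ((m + 1).factorial : ℝ) *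
        (m.choose k : ℝ) * log k := by
  have hsplit : raabePrimitive m =
      (fun y => y ^ (m + 1) / (m + 1).factorial * log y) +
      ((-(harmonic (m + 1) : ℝ) / (m + 1).factorial) • (fun y => y ^ (m + 1)) +
      (1 / 2 * log (2 * π) / m.factorial) • (fun y => y ^ m)) := by
    ext y
    simp only [raabePrimitive, Pi.add_apply, Pi.smul_apply, smul_eq_mul]
    ring
  have hlog : Δ_[1] ^[m] (fun y : ℝ => y ^ (m + 1) / (m + 1).factorial * log y) 0 =
      ∑ k ∈ Finset.Icc 2 m, (-1 : ℝ) ^ (m + k) * (k : ℝ) ^ (m + 1) / ((m + 1).factorial : ℝ) *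
        (m.choose k : ℝ) * log k := by
    rw [fwdDiff_iter_eq_sum_shift]
    symm
    refine Finset.sum_subset_zero_on_sdiff (fun k hk => ?_) (fun k hk => ?_) (fun k hk => ?_)
    · simp only [Finset.mem_Icc] at hk
      simp only [Finset.mem_range]
      lia
    -- The factor k^{m+1} kills k = 0, and log 1 = 0 kills k = 1.
    · have : k = 0 ∨ k = 1 := by
        simp only [Finset.mem_sdiff, Finset.mem_range, Finset.mem_Icc] at hk
        lia
      rcases this with rfl | rfl <;> simp
    · have hk' : k ≤ m := (Finset.mem_Icc.1 hk).2
      have hsign : (-1 : ℝ) ^ (m + k) = (-1) ^ (m - k) := by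
        obtain ⟨j, rfl⟩ := Nat.exists_eq_add_of_le hk'
        rw [Nat.add_sub_cancel_left, show k + j + k = j + 2 * k by ring, pow_add, pow_mul]
        simp
      rw [hsign]
      simp only [zsmul_eq_mul, nsmul_eq_mul, zero_add, mul_one]
      push_cast
      ring
  have hf : ((m + 1).factorial : ℝ) ≠ 0 := by positivity
  have hf' : (m.factorial : ℝ) ≠ 0 := by positivity
  rw [hsplit, fwdDiff_iter_add, fwdDiff_iter_add, fwdDiff_iter_const_smul,
    fwdDiff_iter_const_smul, Pi.add_apply, Pi.add_apply, hlog, Pi.smul_apply, Pi.smul_apply,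
    fwdDiff_iter_pow_succ, fwdDiff_iter_eq_factorial]
  simp only [smul_eq_mul, Pi.natCast_apply]
  field_simp
  ring

/-! ### Integration over the cube -/

/-- Lebesgue measure on the unit cube of dimension `n`. -/
noncomputable abbrev cubeMeasure (n : ℕ) : Measure (Fin n → ℝ) :=
  Measure.pi fun _ => volume.restrict (Ioc (0 : ℝ) 1)

theorem cubeMeasure_eq (n : ℕ) :
    cubeMeasure n = volume.restrict (univ.pi fun _ : Fin n => Ioc (0 : ℝ) 1) := by
  rw [volume_pi, Measure.restrict_pi_pi]

theorem restrict_Icc_eq_cubeMeasure (n : ℕ) :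
    volume.restrict (Icc (0 : Fin n → ℝ) 1) = cubeMeasure n := by
  rw [← pi_univ_Icc, volume_pi, Measure.restrict_pi_pi]
  simp [cubeMeasure, restrict_Ioc_eq_restrict_Icc]

theorem exists_abs_log_Gamma_le (M : ℝ) :
    ∃ C, ∀ s, 0 < s → s ≤ M → |log (Gamma s)| ≤ C + |log s| := by
  obtain ⟨C, hC⟩ := (isCompact_Icc (a := (0 : ℝ)) (b := M)).exists_bound_of_continuousOn
    (f := fun s => log (Gamma (s + 1)))
    (continuousOn_log_Gamma.comp (by fun_prop) fun s hs => mem_Ioi.2 (by linarith [hs.1]))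
  refine ⟨C, fun s hs hsM => ?_⟩
  have h := hC s ⟨hs.le, hsM⟩
  rw [show log (Gamma s) = log (Gamma (s + 1)) - log s by rw [log_Gamma_add_one hs]; ring]
  exact (abs_sub _ _).trans (by gcongr; exact h)

/-- On the half-open cube x_0 ≤ y + ∑ x_i ≤ y + n + 1, so one coordinate controls the singularity:
|log x_0| plus a constant dominates. -/
theorem integrable_log_Gamma_add_sum (n : ℕ) {y : ℝ} (hy : 0 ≤ y) :
    Integrable (fun x : Fin (n + 1) → ℝ => log (Gamma (y + ∑ i, x i))) (cubeMeasure (n + 1)) := by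
  obtain ⟨C, hC⟩ := exists_abs_log_Gamma_le (y + (n + 1))
  have hmem : ∀ᵐ x ∂cubeMeasure (n + 1), x ∈ univ.pi fun _ : Fin (n + 1) => Ioc (0 : ℝ) 1 := by
    rw [cubeMeasure_eq]
    exact ae_restrict_mem (MeasurableSet.univ_pi fun _ => measurableSet_Ioc)
  have hle : ∀ x ∈ univ.pi fun _ : Fin (n + 1) => Ioc (0 : ℝ) 1, x 0 ≤ y + ∑ i, x i :=
    fun x hx => (Finset.single_le_sum (f := x) (fun i _ => (hx i trivial).1.le)
      (Finset.mem_univ 0)).trans (by linarith)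
  have hdom : Integrable (fun x : Fin (n + 1) → ℝ => C + |log (y + (n + 1))| + |log (x 0)|)
      (cubeMeasure (n + 1)) := by
    refine (integrable_const _).add (Integrable.abs ?_)
    exact integrable_comp_eval (μ := fun _ : Fin (n + 1) => volume.restrict (Ioc (0 : ℝ) 1))
      (f := log) (i := 0) ((intervalIntegrable_iff_integrableOn_Ioc_of_le zero_le_one).1
        intervalIntegrable_log')
  refine hdom.mono' ?_ ?_
  · rw [cubeMeasure_eq]
    refine ContinuousOn.aestronglyMeasurable ?_
      (MeasurableSet.univ_pi fun _ => measurableSet_Ioc)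
    exact continuousOn_log_Gamma.comp (by fun_prop)
      fun x hx => mem_Ioi.2 ((hx 0 trivial).1.trans_le (hle x hx))
  · filter_upwards [hmem] with x hx
    have h0 := (hx 0 trivial).1
    have hs := hle x hx
    have hM : y + ∑ i, x i ≤ y + (n + 1) := by
      have : ∑ i, x i ≤ ∑ _i : Fin (n + 1), (1 : ℝ) :=
        Finset.sum_le_sum fun i _ => (hx i trivial).2
      simpa using this
    refine (hC _ (h0.trans_le hs) hM).trans ?_
    rw [add_assoc]
    gcongr
    have h1 := log_le_log h0 hs
    have h2 := log_le_log (h0.trans_le hs) hM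
    rw [abs_le]
    constructor
    · linarith [neg_abs_le (log (x 0)), abs_nonneg (log (y + (n + 1)))]
    · linarith [le_abs_self (log (y + (n + 1))), abs_nonneg (log (x 0))]

/-- Fubini splits off coordinate 0, which is absorbed into the shift. -/
theorem integral_cubeMeasure_succ (n : ℕ) {f : ℝ → ℝ} {y : ℝ}
    (hf : Integrable (fun x : Fin (n + 1) → ℝ => f (y + ∑ i, x i)) (cubeMeasure (n + 1))) :
    ∫ x, f (y + ∑ i, x i) ∂cubeMeasure (n + 1) =
      ∫ s in y..y + 1, ∫ x, f (s + ∑ i, x i) ∂cubeMeasure n := by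
  have hmp := (measurePreserving_piFinSuccAbove
    (fun _ : Fin (n + 1) => (volume : Measure ℝ).restrict (Ioc (0 : ℝ) 1)) 0).symm
  rw [← hmp.integrable_comp_emb (MeasurableEquiv.measurableEmbedding _)] at hf
  have h := integral_prod _ hf
  simp only [Function.comp_apply] at h
  have hsub := integral_comp_add_left (fun s => ∫ x, f (s + ∑ i, x i) ∂cubeMeasure n)
    (a := 0) (b := 1) y
  rw [add_zero] at hsub
  rw [← hmp.integral_comp', h, ← hsub, integral_of_le zero_le_one]
  simp [Fin.sum_univ_succ, add_assoc]

open fwdDiff in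
theorem integral_log_Gamma_add_sum (m : ℕ) {y : ℝ} (hy : 0 ≤ y) :
    ∫ x : Fin (m + 1) → ℝ, log (Gamma (y + ∑ i, x i)) ∂cubeMeasure (m + 1) =
      Δ_[1] ^[m] (raabePrimitive m) y := by
  induction m generalizing y with
  | zero =>
    rw [integral_cubeMeasure_succ 0 (f := fun s => log (Gamma s))
      (integrable_log_Gamma_add_sum 0 hy)]
    simp [integral_log_Gamma_add_one hy, raabePrimitive, cubeMeasure, Measure.real]
    ring
  | succ m ih =>
    rw [integral_cubeMeasure_succ (m + 1) (f := fun s => log (Gamma s))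
      (integrable_log_Gamma_add_sum (m + 1) hy), ← integral_fwdDiff_iter_raabePrimitive m hy]
    refine integral_congr fun s hs => ih ?_
    rw [uIcc_of_le (by linarith)] at hs
    exact hy.trans hs.1

theorem theorem1p2 (n : ℕ) (hn : 1 ≤ n) :
    MeasureTheory.IntegrableOn
        (fun x : Fin n → ℝ => Real.log (Real.Gamma (∑ i, x i)))
        (Set.Icc (0 : Fin n → ℝ) 1) MeasureTheory.volume ∧
      ∫ x in Set.Icc (0 : Fin n → ℝ) 1, Real.log (Real.Gamma (∑ i, x i)) =
        1 / 2 * Real.log (2 * Real.pi) - ((n : ℝ) - 1) / 2 * (harmonic n : ℝ) +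
          ∑ k ∈ Finset.Icc 2 (n - 1),
            (-1 : ℝ) ^ (n + k + 1) * (k : ℝ) ^ n / (n.factorial : ℝ) *
              ((n - 1).choose k : ℝ) * Real.log (k : ℝ) := by
  obtain ⟨m, rfl⟩ := Nat.exists_eq_add_of_le' hn
  have hint := integrable_log_Gamma_add_sum m le_rfl
  have hval := integral_log_Gamma_add_sum m le_rfl
  simp only [zero_add] at hint hval
  rw [IntegrableOn, restrict_Icc_eq_cubeMeasure]
  refine ⟨hint, ?_⟩
  rw [hval, fwdDiff_iter_raabePrimitive_zero]
  have hsign (k : ℕ) : (-1 : ℝ) ^ (m + 1 + k + 1) = (-1) ^ (m + k) := by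
    rw [show m + 1 + k + 1 = m + k + 2 by ring, pow_add]
    simp
  simp [hsign]
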